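/- Let $\mathbb{K}=\mathbb{R}$ or $\mathbb{C}$, let $n\ge 1$, and let $\mathrm{M}_n=\mathrm{M}_n(\mathbb{K})$ be the $\mathbb{K}$-algebra of $n\times n$ matrices over $\mathbb{K}$. For an abelian group $(\Gamma,+)$ and a bilinear (i.e. biadditive) map $\langle\,,\,\rangle:\Gamma\times\Gamma\to\mathbb{Z}/2\mathbb{Z}$, a $\mathbb{K}$-algebra $\mathcal{A}$ is called $\Gamma$-commutative if it is equipped with a decomposition into linear subspaces $\mathcal{A}=\bigoplus_{\gamma\in\Gamma}\mathcal{A}_\gamma$ such that $\mathcal{A}_\gamma\cdot\mathcal{A}_{\gamma'}\subset\mathcal{A}_{\gamma+\gamma'}$ for all $\gamma,\gamma'\in\Gamma$, and $$a\,b=(-1)^{\langle\gamma,\gamma'\rangle}\,b\,a\qquad\text{for all }\gamma,\gamma'\in\Gamma,\ a\in\mathcal{A}_\gamma,\ b\in\mathcal{A}_{\gamma'}.$$ Then there exist an abelian group $\Gamma$, a bilinear map $\langle\,,\,\rangle:\Gamma\times\Gamma\to\mathbb{Z}/2\mathbb{Z}$ and a $\Gamma$-grading of $\mathrm{M}_n$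 making it a $\Gamma$-commutative algebra if and only if $n=2^m$ for some integer $m\ge 0$. -/

import Mathlib

/-- `𝒜` is a `Γ`-grading of the (not necessarily unital or associative) `K`-algebra `A`:
`A = ⨁ γ, 𝒜 γ` as a vector space and `𝒜 γ * 𝒜 δ ⊆ 𝒜 (γ + δ)`. -/
structure IsAlgGrading {K Γ A : Type*} [Field K] [AddCommGroup Γ]
    [NonUnitalNonAssocRing A] [Module K A] (𝒜 : Γ → Submodule K A) : Prop where
  isInternal : open Classical in DirectSum.IsInternal 𝒜
  mul_mem : ∀ (γ δ : Γ) (a b : A), a ∈ 𝒜 γ → b ∈ 𝒜 δ → a * b ∈ 𝒜 (γ + δ)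

/-- The algebra `A`, graded by `𝒜`, is `Γ`-commutative with respect to the bilinear map
`β : Γ × Γ → ℤ/2ℤ`: homogeneous elements satisfy `a b = (-1)^{β(deg a, deg b)} b a`. -/
structure IsGradedCommutative {K Γ A : Type*} [Field K] [AddCommGroup Γ]
    [NonUnitalNonAssocRing A] [Module K A] (β : Γ →+ Γ →+ ZMod 2)
    (𝒜 : Γ → Submodule K A) : Prop extends IsAlgGrading 𝒜 where
  comm : ∀ (γ δ : Γ) (a b : A), a ∈ 𝒜 γ → b ∈ 𝒜 δ →
    a * b = (-1 : K) ^ (β γ δ).val • (b * a)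

/-!
In a graded commutative simple algebra the right annihilator of a homogeneous element is a
two-sided ideal, so nonzero homogeneous elements are cancellable. If `a` and `b` have the same
degree `γ`, then `β (γ + γ) = 0` puts `a * b` into the center. Over a central simple algebra this
forces every homogeneous component to be at most one-dimensional and `γ + γ = 0`, so the degrees
that occur form an elementary abelian 2-group whose order is the dimension of the algebra. For
`n × n` matrices, `n ^ 2` is therefore a power of two.

Conversely, let `V` be a vector space over `ZMod 2`. The operators on functions on `V` that multiply
by a character `(-1) ^ f` and then translate by a vector `v` commute up to sign, multiply up to
sign, and form a basis of the matrices indexed by `V`.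
-/

namespace IsAlgGrading

open Submodule

section Homogeneous

variable {K Γ A : Type*} [Field K] [AddCommGroup Γ] [NonUnitalNonAssocRing A] [Module K A]
  {𝒜 : Γ → Submodule K A} (h𝒜 : IsAlgGrading 𝒜)
include h𝒜

theorem iSup_eq_top : ⨆ γ, 𝒜 γ = ⊤ := by
  classical
  exact DirectSum.IsInternal.submodule_iSup_eq_top (by convert h𝒜.isInternal)

theorem iSupIndep : iSupIndep 𝒜 := by
  classical
  exact DirectSum.IsInternal.submodule_iSupIndep (by convert h𝒜.isInternal)

theorem degree_unique {γ δ : Γ} {a : A} (ha₀ : a ≠ 0) (hγ : a ∈ 𝒜 γ) (hδ : a ∈ 𝒜 δ) : γ = δ := by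
  by_contra hne
  exact ha₀ (disjoint_def.1 (h𝒜.iSupIndep.pairwiseDisjoint hne) a hγ hδ)

theorem degree_eq_zero_of_isIdempotentElem {γ : Γ} {a : A} (ha₀ : a ≠ 0) (ha : a ∈ 𝒜 γ)
    (hidem : IsIdempotentElem a) : γ = 0 := by
  have hsq : a ∈ 𝒜 (γ + γ) := by simpa only [hidem.eq] using h𝒜.mul_mem γ γ a a ha ha
  exact add_eq_left.1 (h𝒜.degree_unique ha₀ hsq ha)

@[elab_as_elim]
theorem homogeneous_induction {motive : A → Prop} (a : A)
    (mem : ∀ γ, ∀ b ∈ 𝒜 γ, motive b) (add : ∀ b c, motive b → motive c → motive (b + c)) :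
    motive a :=
  iSup_induction 𝒜 (motive := motive) (h𝒜.iSup_eq_top.ge mem_top) mem (mem 0 0 (zero_mem _)) add

theorem nonempty_basis_of_isPrincipal (hprin : ∀ γ, (𝒜 γ).IsPrincipal) :
    Nonempty (Module.Basis {γ // 𝒜 γ ≠ ⊥} K A) := by
  let e (γ : {γ // 𝒜 γ ≠ ⊥}) : A := IsPrincipal.generator (𝒜 γ)
  have hli : LinearIndependent K e :=
    (h𝒜.iSupIndep.comp Subtype.val_injective).linearIndependent _
      (fun γ ↦ IsPrincipal.generator_mem (𝒜 γ))
      fun γ h₀ ↦ γ.2 ((IsPrincipal.eq_bot_iff_generator_eq_zero _).2 h₀)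
  have hspan : span K (Set.range e) = ⊤ := by
    simp only [e, span_range_eq_iSup, IsPrincipal.span_singleton_generator,
      iSup_ne_bot_subtype, h𝒜.iSup_eq_top]
  exact ⟨.mk hli hspan.ge⟩

end Homogeneous

theorem span_singleton_basis {K Γ A : Type*} [Field K] [AddCommGroup Γ] [NonUnitalNonAssocRing A]
    [Module K A] [IsScalarTower K A A] [SMulCommClass K A A] (b : Module.Basis Γ K A)
    (hmul : ∀ γ δ, b γ * b δ ∈ K ∙ b (γ + δ)) : IsAlgGrading fun γ ↦ K ∙ b γ where
  isInternal := by
    classical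
    refine DirectSum.isInternal_submodule_of_iSupIndep_of_iSup_eq_top
      b.linearIndependent.iSupIndep_span_singleton ?_
    rw [← span_range_eq_iSup, b.span_eq]
  mul_mem γ δ x y hx hy := by
    obtain ⟨c, rfl⟩ := mem_span_singleton.1 hx
    obtain ⟨d, rfl⟩ := mem_span_singleton.1 hy
    rw [smul_mul_smul_comm]
    exact smul_mem _ _ (hmul γ δ)

end IsAlgGrading

namespace IsGradedCommutative

open Submodule

theorem span_singleton_basis {K Γ A : Type*} [Field K] [AddCommGroup Γ] [NonUnitalNonAssocRing A]
    [Module K A] [IsScalarTower K A A] [SMulCommClass K A A] {β : Γ →+ Γ →+ ZMod 2}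
    (b : Module.Basis Γ K A) (hmul : ∀ γ δ, b γ * b δ ∈ K ∙ b (γ + δ))
    (hcomm : ∀ γ δ, b γ * b δ = (-1 : K) ^ (β γ δ).val • (b δ * b γ)) :
    IsGradedCommutative β fun γ ↦ K ∙ b γ where
  toIsAlgGrading := .span_singleton_basis b hmul
  comm γ δ x y hx hy := by
    obtain ⟨c, rfl⟩ := mem_span_singleton.1 hx
    obtain ⟨d, rfl⟩ := mem_span_singleton.1 hy
    rw [smul_mul_smul_comm, smul_mul_smul_comm, hcomm, smul_comm, mul_comm c d]

variable {K Γ A : Type*} [Field K] [AddCommGroup Γ] [Ring A] [Algebra K A]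
  {β : Γ →+ Γ →+ ZMod 2} {𝒜 : Γ → Submodule K A} (h𝒜 : IsGradedCommutative β 𝒜)
include h𝒜

theorem mem_center {γ : Γ} (hγ : β γ = 0) {a : A} (ha : a ∈ 𝒜 γ) :
    a ∈ Subalgebra.center K A := by
  refine Subalgebra.mem_center_iff.2 fun x ↦ ?_
  induction x using h𝒜.homogeneous_induction with
  | mem δ b hb => simp [h𝒜.comm γ δ a b ha hb, hγ]
  | add b c hb hc => rw [mul_add, add_mul, hb, hc]

theorem mul_mul_eq_zero_of_mul_eq_zero {γ : Γ} {a x : A} (ha : a ∈ 𝒜 γ) (hax : a * x = 0) (y : A) :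
    a * (y * x) = 0 := by
  induction y using h𝒜.homogeneous_induction with
  | mem δ b hb =>
    rw [← mul_assoc, h𝒜.comm γ δ a b ha hb, smul_mul_assoc, mul_assoc, hax, mul_zero, smul_zero]
  | add b c hb hc => rw [add_mul, mul_add, hb, hc, add_zero]

theorem exists_mul_eq_algebraMap [Algebra.IsCentral K A] {γ : Γ} {a b : A} (ha : a ∈ 𝒜 γ)
    (hb : b ∈ 𝒜 γ) : ∃ c, a * b = algebraMap K A c := by
  have hβ : β (γ + γ) = 0 := by
    ext δ
    rw [map_add, AddMonoidHom.add_apply, CharTwo.add_self_eq_zero, AddMonoidHom.zero_apply]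
  exact (Algebra.IsCentral.mem_center_iff K).1 (h𝒜.mem_center hβ (h𝒜.mul_mem γ γ a b ha hb))

variable [IsSimpleRing A]

theorem isLeftRegular {γ : Γ} {a : A} (ha : a ∈ 𝒜 γ) (ha₀ : a ≠ 0) : IsLeftRegular a := by
  -- Graded commutativity makes the right annihilator of `a` a two-sided ideal.
  let ann : TwoSidedIdeal A := .mk' {x | a * x = 0} (mul_zero a)
    (fun {x y} (hx : a * x = 0) (hy : a * y = 0) ↦ by simp [mul_add, hx, hy])
    (fun {x} (hx : a * x = 0) ↦ by simp [hx])
    (fun {x y} hy ↦ h𝒜.mul_mul_eq_zero_of_mul_eq_zero ha hy x)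
    (fun {x y} (hx : a * x = 0) ↦ by simp [← mul_assoc, hx])
  have mem_ann (x : A) : x ∈ ann ↔ a * x = 0 := TwoSidedIdeal.mem_mk' _ _ _ _ _ _ x
  refine isLeftRegular_iff_right_eq_zero_of_mul.2 fun x hx ↦ by_contra fun hx₀ ↦ ha₀ ?_
  have hone : 1 ∈ ann := IsSimpleRing.one_mem_of_ne_zero_mem ann hx₀ ((mem_ann x).2 hx)
  rwa [mem_ann, mul_one] at hone

theorem mul_ne_zero {γ : Γ} {a x : A} (ha : a ∈ 𝒜 γ) (ha₀ : a ≠ 0) (hx₀ : x ≠ 0) : a * x ≠ 0 :=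
  mt (isLeftRegular_iff_right_eq_zero_of_mul.1 (h𝒜.isLeftRegular ha ha₀) x) hx₀

variable [Algebra.IsCentral K A]

theorem exists_mul_self_eq_algebraMap {γ : Γ} {a : A} (ha : a ∈ 𝒜 γ) (ha₀ : a ≠ 0) :
    ∃ c ≠ 0, a * a = algebraMap K A c := by
  obtain ⟨c, hc⟩ := h𝒜.exists_mul_eq_algebraMap ha ha
  refine ⟨c, ?_, hc⟩
  rintro rfl
  exact h𝒜.mul_ne_zero ha ha₀ ha₀ (by rw [hc, map_zero])

theorem add_self_eq_zero {γ : Γ} {a : A} (ha : a ∈ 𝒜 γ) (ha₀ : a ≠ 0) : γ + γ = 0 := by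
  obtain ⟨c, hc₀, hc⟩ := h𝒜.exists_mul_self_eq_algebraMap ha ha₀
  have hone : (1 : A) ∈ 𝒜 (γ + γ) := by
    rw [← (𝒜 (γ + γ)).smul_mem_iff hc₀, ← Algebra.algebraMap_eq_smul_one, ← hc]
    exact h𝒜.mul_mem γ γ a a ha ha
  exact h𝒜.degree_eq_zero_of_isIdempotentElem one_ne_zero hone .one

theorem le_span_singleton {γ : Γ} {a : A} (ha : a ∈ 𝒜 γ) (ha₀ : a ≠ 0) : 𝒜 γ ≤ K ∙ a := by
  intro b hb
  obtain ⟨c, hc₀, hc⟩ := h𝒜.exists_mul_self_eq_algebraMap ha ha₀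
  obtain ⟨d, hd⟩ := h𝒜.exists_mul_eq_algebraMap ha hb
  -- `a` cancels from `a * (c • b) = c d = a * (d • a)`.
  have hcb : c • b = d • a := h𝒜.isLeftRegular ha ha₀ <| by
    simp only [mul_smul_comm, hc, hd, Algebra.algebraMap_eq_smul_one, smul_smul, mul_comm]
  exact mem_span_singleton.2 ⟨c⁻¹ * d, by rw [mul_smul, ← hcb, inv_smul_smul₀ hc₀]⟩

theorem isPrincipal (γ : Γ) : (𝒜 γ).IsPrincipal := by
  obtain hγ | hγ := eq_or_ne (𝒜 γ) ⊥
  · exact hγ ▸ inferInstance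
  · obtain ⟨a, ha, ha₀⟩ := exists_mem_ne_zero_of_ne_bot hγ
    exact ⟨a, (h𝒜.le_span_singleton ha ha₀).antisymm ((span_singleton_le_iff_mem a _).2 ha)⟩

/-- The subgroup of degrees that occur in a graded commutative central simple algebra. -/
def support : AddSubgroup Γ where
  carrier := {γ | 𝒜 γ ≠ ⊥}
  add_mem' {γ δ} hγ hδ := by
    obtain ⟨a, ha, ha₀⟩ := exists_mem_ne_zero_of_ne_bot hγ
    obtain ⟨b, hb, hb₀⟩ := exists_mem_ne_zero_of_ne_bot hδ
    exact (Submodule.ne_bot_iff _).2 ⟨a * b, h𝒜.mul_mem γ δ a b ha hb, h𝒜.mul_ne_zero ha ha₀ hb₀⟩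
  zero_mem' := by
    obtain ⟨γ, hγ⟩ : ∃ γ, 𝒜 γ ≠ ⊥ := by
      by_contra! hbot
      exact bot_ne_top ((iSup_eq_bot.2 hbot).symm.trans h𝒜.iSup_eq_top)
    obtain ⟨a, ha, ha₀⟩ := exists_mem_ne_zero_of_ne_bot hγ
    exact (Submodule.ne_bot_iff _).2 ⟨a * a, h𝒜.add_self_eq_zero ha ha₀ ▸ h𝒜.mul_mem γ γ a a ha ha,
      h𝒜.mul_ne_zero ha ha₀ ha₀⟩
  neg_mem' {γ} hγ := by
    obtain ⟨a, ha, ha₀⟩ := exists_mem_ne_zero_of_ne_bot hγ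
    rwa [Set.mem_ofPred_eq, neg_eq_of_add_eq_zero_left (h𝒜.add_self_eq_zero ha ha₀)]

theorem two_nsmul_support (γ : h𝒜.support) : 2 • γ = 0 := by
  obtain ⟨a, ha, ha₀⟩ := exists_mem_ne_zero_of_ne_bot γ.2
  exact Subtype.ext ((two_nsmul _).trans (h𝒜.add_self_eq_zero ha ha₀))

theorem exists_finrank_eq_two_pow [FiniteDimensional K A] :
    ∃ k : ℕ, Module.finrank K A = 2 ^ k := by
  obtain ⟨b⟩ : Nonempty (Module.Basis h𝒜.support K A) :=
    h𝒜.nonempty_basis_of_isPrincipal h𝒜.isPrincipal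
  have : Finite h𝒜.support := Module.Finite.finite_basis b
  let _ : Module (ZMod 2) h𝒜.support := AddCommGroup.zmodModule h𝒜.two_nsmul_support
  exact ⟨Module.finrank (ZMod 2) h𝒜.support, by
    rw [Module.finrank_eq_nat_card_basis b, Module.natCard_eq_pow_finrank (K := ZMod 2),
      Nat.card_zmod]⟩

end IsGradedCommutative

theorem IsGradedCommutative.exists_card_eq_two_pow {K Γ ι : Type*} [Field K] [AddCommGroup Γ]
    [Fintype ι] [Nonempty ι] {β : Γ →+ Γ →+ ZMod 2}
    {𝒜 : Γ → Submodule K (Matrix ι ι K)} (h𝒜 : IsGradedCommutative β 𝒜) :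
    ∃ m : ℕ, Fintype.card ι = 2 ^ m := by
  classical
  obtain ⟨k, hk⟩ := h𝒜.exists_finrank_eq_two_pow
  rw [Module.finrank_matrix, Module.finrank_self, mul_one] at hk
  obtain ⟨m, -, hm⟩ := (Nat.dvd_prime_pow Nat.prime_two).1 (Dvd.intro _ hk)
  exact ⟨m, hm⟩

section Weyl

open Module

/-- The Weyl matrix of `γ = (f, v)`: multiplication of functions on `V` by the character `ψ ∘ f`
followed by translation by `v`. For `R = ZMod 2`, `V = R ^ m` and `ψ t = (-1) ^ t`, these are, up to
scalars, the `m`-fold tensor products of Pauli matrices. -/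
def weylMatrix {R V K : Type*} [CommRing R] [AddCommGroup V] [Module R V] [DecidableEq V]
    [Semiring K] (ψ : AddChar R K) (γ : Dual R V × V) : Matrix V V K :=
  Matrix.of fun i j ↦ if i = j + γ.2 then ψ (γ.1 j) else 0

section Mul

variable {R V K : Type*} [CommRing R] [AddCommGroup V] [Module R V] [DecidableEq V]
  [Semiring K] (ψ : AddChar R K)

theorem weylMatrix_apply (γ : Dual R V × V) (i j : V) :
    weylMatrix ψ γ i j = if i = j + γ.2 then ψ (γ.1 j) else 0 := rfl

variable [Fintype V]

theorem weylMatrix_mul (γ δ : Dual R V × V) :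
    weylMatrix ψ γ * weylMatrix ψ δ = ψ (γ.1 δ.2) • weylMatrix ψ (γ + δ) := by
  ext i j
  have hchar : ψ (γ.1 (j + δ.2)) * ψ (δ.1 j) = ψ (γ.1 δ.2) * ψ ((γ + δ).1 j) := by
    simp only [← AddChar.map_add_eq_mul, map_add, Prod.fst_add, LinearMap.add_apply]
    congr 1
    ring
  rw [Matrix.mul_apply, Finset.sum_eq_single (j + δ.2)
    (fun k _ hk ↦ by simp [weylMatrix_apply, hk]) (by simp)]
  simp only [weylMatrix_apply, Matrix.smul_apply, smul_eq_mul, if_true, hchar, ite_mul, zero_mul,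
    mul_ite, mul_zero, Prod.snd_add, add_assoc, add_comm δ.2]

theorem weylMatrix_mul_comm (γ δ : Dual R V × V) :
    weylMatrix ψ γ * weylMatrix ψ δ =
      ψ (γ.1 δ.2 - δ.1 γ.2) • (weylMatrix ψ δ * weylMatrix ψ γ) := by
  rw [weylMatrix_mul, weylMatrix_mul, smul_smul, ← AddChar.map_add_eq_mul, sub_add_cancel,
    add_comm δ]

end Mul

theorem linearIndependent_addChar (G L : Type*) [AddMonoid G] [CommRing L] [IsDomain L] :
    LinearIndependent L fun ψ : AddChar G L ↦ (ψ : G → L) :=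
  (linearIndependent_monoidHom (Multiplicative G) L).comp _ AddChar.toMonoidHomEquiv.injective

theorem linearIndependent_piSingle_prod {ι κ K M : Type*} [DecidableEq ι] [Ring K]
    [AddCommGroup M] [Module K M] {v : κ → M} (hv : LinearIndependent K v) :
    LinearIndependent K fun p : κ × ι ↦ (Pi.single p.2 (v p.1) : ι → M) :=
  (Pi.linearIndependent_single (fun _ : ι ↦ v) fun _ ↦ hv).comp
    ((Equiv.prodComm κ ι).trans (Equiv.sigmaEquivProd ι κ).symm) (Equiv.injective _)

theorem linearIndependent_weylMatrix {R V K : Type*} [CommRing R] [AddCommGroup V] [Module R V]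
    [DecidableEq V] [CommRing K] [IsDomain K] {ψ : AddChar R K} (hψ : Function.Injective ψ) :
    LinearIndependent K (weylMatrix (V := V) ψ) := by
  let diagonals : Matrix V V K →ₗ[K] V → V → K :=
    { toFun M v j := M (j + v) j
      map_add' _ _ := rfl
      map_smul' _ _ := rfl }
  let character (f : Dual R V) : AddChar V K := ψ.compAddMonoidHom f.toAddMonoidHom
  have character_injective : Function.Injective character :=
    (AddChar.compAddMonoidHom_injective_right ψ hψ).comp LinearMap.toAddMonoidHom_injective
  have hchar : LinearIndependent K fun f ↦ ⇑(character f) :=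
    (linearIndependent_addChar V K).comp _ character_injective
  have hsingle := linearIndependent_piSingle_prod (ι := V) hchar
  -- The only nonzero diagonal of `weylMatrix ψ (f, v)` is the one of offset `v`, equal to `ψ ∘ f`.
  have hdiag (γ : Dual R V × V) :
      diagonals (weylMatrix ψ γ) = Pi.single γ.2 ⇑(character γ.1) := by
    ext v j
    change weylMatrix ψ γ (j + v) j = _
    simp only [weylMatrix_apply, Pi.single_apply, add_right_inj]
    split_ifs <;> rfl
  exact .of_comp diagonals (by simpa only [Function.comp_def, hdiag] using hsingle)

theorem span_weylMatrix {F V K : Type*} [Field F] [AddCommGroup V] [Module F V]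
    [Finite V] [DecidableEq V] [Field K] {ψ : AddChar F K} (hψ : Function.Injective ψ) :
    Submodule.span K (Set.range (weylMatrix (V := V) ψ)) = ⊤ := by
  have := Fintype.ofFinite V
  let dualEquiv : V ≃ₗ[F] Dual F V := .ofFinrankEq _ _ Subspace.dual_finrank_eq.symm
  let _ : Fintype (Dual F V) := .ofEquiv V dualEquiv.toEquiv
  refine (linearIndependent_weylMatrix hψ).span_eq_top_of_card_eq_finrank' ?_
  rw [finrank_matrix, finrank_self, mul_one, Fintype.card_prod,
    Fintype.card_congr dualEquiv.toEquiv]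

/-- The Weyl matrices as a basis of the matrix algebra. -/
noncomputable def weylBasis {F : Type*} (V : Type*) {K : Type*} [Field F] [AddCommGroup V]
    [Module F V] [Finite V] [DecidableEq V] [Field K] {ψ : AddChar F K}
    (hψ : Function.Injective ψ) : Basis (Dual F V × V) K (Matrix V V K) :=
  .mk (linearIndependent_weylMatrix hψ) (span_weylMatrix hψ).ge

theorem weylBasis_apply {F V K : Type*} [Field F] [AddCommGroup V] [Module F V] [Finite V]
    [DecidableEq V] [Field K] {ψ : AddChar F K} (hψ : Function.Injective ψ) (γ : Dual F V × V) :
    weylBasis V hψ γ = weylMatrix ψ γ :=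
  Basis.mk_apply _ _ γ

/-- The commutation form `⟨(f, v), (g, w)⟩ = f w + g v` of the Weyl matrices. -/
def weylForm (V : Type*) [AddCommGroup V] [Module (ZMod 2) V] :
    Dual (ZMod 2) V × V →+ Dual (ZMod 2) V × V →+ ZMod 2 :=
  LinearMap.toAddMonoidHom'.comp (LinearMap.dualProd (ZMod 2) V).toAddMonoidHom

theorem weylForm_apply {V : Type*} [AddCommGroup V] [Module (ZMod 2) V]
    (γ δ : Dual (ZMod 2) V × V) : weylForm V γ δ = γ.1 δ.2 - δ.1 γ.2 := by
  rw [CharTwo.sub_eq_add, add_comm]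
  exact LinearMap.dualProd_apply_apply (ZMod 2) V γ δ

theorem zmodChar_injective {M : Type*} [CommMonoid M] {n : ℕ} [NeZero n] {ζ : M}
    (hζ : IsPrimitiveRoot ζ n) : Function.Injective (AddChar.zmodChar n hζ.pow_eq_one) :=
  fun s t hst ↦ ZMod.val_injective n (hζ.pow_inj s.val_lt t.val_lt hst)

theorem isGradedCommutative_weylForm {V K A : Type*} [AddCommGroup V] [Module (ZMod 2) V]
    [Fintype V] [DecidableEq V] [Field K] (hK : ringChar K ≠ 2) [Ring A] [Algebra K A]
    (e : Matrix V V K ≃ₐ[K] A) :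
    ∃ 𝒜 : Dual (ZMod 2) V × V → Submodule K A, IsGradedCommutative (weylForm V) 𝒜 := by
  have hprim : IsPrimitiveRoot (-1 : K) 2 := .neg_one (ringChar K) hK
  let sign : AddChar (ZMod 2) K := AddChar.zmodChar 2 hprim.pow_eq_one
  have sign_injective : Function.Injective sign := zmodChar_injective hprim
  let b := (weylBasis V sign_injective).map e.toLinearEquiv
  have hb (γ) : b γ = e (weylMatrix sign γ) := congrArg e (weylBasis_apply sign_injective γ)
  refine ⟨_, .span_singleton_basis b (fun γ δ ↦ ?_) fun γ δ ↦ ?_⟩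
  · simp only [hb, ← map_mul, weylMatrix_mul, map_smul]
    exact Submodule.smul_mem _ _ (Submodule.mem_span_singleton_self _)
  · rw [hb, hb, ← map_mul, ← map_mul, weylMatrix_mul_comm, map_smul, ← weylForm_apply,
      AddChar.zmodChar_apply]

end Weyl

theorem mainTheorem1_general (K ι : Type*) [Field K] (hK : ringChar K ≠ 2) [Fintype ι]
    [Nonempty ι] :
    (∃ (Γ : Type*) (_ : AddCommGroup Γ) (β : Γ →+ Γ →+ ZMod 2)
        (𝒜 : Γ → Submodule K (Matrix ι ι K)), IsGradedCommutative β 𝒜) ↔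
      ∃ m : ℕ, Fintype.card ι = 2 ^ m := by
  classical
  constructor
  · rintro ⟨Γ, _, β, 𝒜, h𝒜⟩
    exact h𝒜.exists_card_eq_two_pow
  · rintro ⟨m, hm⟩
    -- `ULift` puts the grading group into the required universe.
    let V := ULift (Fin m) → ZMod 2
    have hcard : Fintype.card V = Fintype.card ι := by simp [V, hm, ZMod.card]
    exact ⟨_, _, weylForm V, isGradedCommutative_weylForm hK
      (Matrix.reindexAlgEquiv K K (Fintype.equivOfCardEq hcard))⟩

theorem mainTheorem1 (𝕜 : Type*) [RCLike 𝕜] (n : ℕ) (hn : 0 < n) :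
    (∃ (Γ : Type*) (_ : AddCommGroup Γ) (β : Γ →+ Γ →+ ZMod 2)
        (𝒜 : Γ → Submodule 𝕜 (Matrix (Fin n) (Fin n) 𝕜)), IsGradedCommutative β 𝒜) ↔
      ∃ m : ℕ, n = 2 ^ m := by
  have : Nonempty (Fin n) := ⟨⟨0, hn⟩⟩
  simpa using mainTheorem1_general 𝕜 (Fin n) (by simp [ringChar.eq_zero])
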